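/- Let $M$ be a smooth finite-dimensional manifold (Hausdorff, second countable, without boundary), let $e\neq 0$ be a real number, and let $\omega\in\Omega^2(M;\mathbb R)$ be a smooth closed $2$-form such that the de Rham class $[\tfrac1e\omega]$ is integral, i.e. lies in the image of the homomorphism $\check H^2(M;\mathbb Z)\to\check H^2(M;\mathbb R)\cong H^2_{dR}(M;\mathbb R)$ induced by the embedding $\mathbb Z\hookrightarrow\mathbb R$, $k\mapsto 2\pi k$ (where $\cong$ is the Čech–de Rham isomorphism). Then there exists an equivalence class $[(L,\langle\cdot,\cdot\rangle,\nabla^\omega)]$ of hermitian line bundles with hermitian connexion over $M$ such that $curv(\nabla^\omega)=\tfrac{i}{e}\,\omega$ for every representative. Here a hermitian line bundle $(L,\langle\cdot,\cdot\rangle)$ is a smooth complex line bundle with a smooth hermitian structure, conjugate-linear in the first argument; with $\Gamma(L)$ its space of smooth sections, a hermitian connexion is a linear map $\nabla:\Gamma(L)\to\Omega^1(M;\mathbb C)\otimes_{C^\infty(M;\mathbb C)}\Gamma(L)$ with $\nabla(fs)=df\otimes s+f\nabla s$ and $X\langle r,s\rangle=\langle\nabla_Xr,s\rangle+\langle r,\nabla_Xs\rangle$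 for all $r,s\in\Gamma(L)$, $f\in C^\infty(M;\mathbb C)$ and real vector fields $X$; its curvature is the imaginary $2$-form with $curv(\nabla)(X,Y)s=\nabla_X\nabla_Ys-\nabla_Y\nabla_Xs-\nabla_{[X,Y]}s$; and $(L,\langle\cdot,\cdot\rangle,\nabla)$, $(L',\langle\cdot,\cdot\rangle',\nabla')$ are equivalent if there is a diffeomorphism $\phi:L\to L'$ over the identity of $M$, a $\mathbb C$-linear isometry on each fibre, with $\phi\circ\nabla_Xs=\nabla'_X(\phi\circ s)$ for all $s\in\Gamma(L)$ and all vector fields $X$. -/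

import Mathlib

open scoped Manifold ContDiff Topology
open Bundle Set

universe u v v'

noncomputable section

namespace LineBundle

/-! ### Differential forms and the exterior derivative on a manifold -/

section Forms

variable {E : Type*} [NormedAddCommGroup E] [NormedSpace ℝ E]
  {M : Type*} [TopologicalSpace M] [ChartedSpace E M]
  {F : Type*} [NormedAddCommGroup F] [NormedSpace ℝ F]

variable (E M F) in
/-- `F`-valued fields of alternating `k`-linear forms on the tangent spaces of `M`, with no
regularity imposed.  Smoothness on an open set is the predicate `Form.SmoothOn`; a form on an open
set `U` is represented by a field on `M` of which only the values on `U` are used. -/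
abbrev Form (k : ℕ) : Type _ :=
  ∀ x : M, TangentSpace 𝓘(ℝ, E) x [⋀^Fin k]→L[ℝ] F

/-- The expression of `η` in the preferred chart at `x₀`, i.e. its pull-back under the inverse of
that chart, as a differential form on (the target of the chart in) the model space `E`. -/
def Form.inChart {k : ℕ} (η : Form E M F k) (x₀ : M) : E → E [⋀^Fin k]→L[ℝ] F := fun y =>
  (η ((extChartAt 𝓘(ℝ, E) x₀).symm y)).compContinuousLinearMap
    (mfderiv 𝓘(ℝ, E) 𝓘(ℝ, E) (extChartAt 𝓘(ℝ, E) x₀).symm y)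

/-- `η` is smooth on `U` (used for open `U`): its coefficients in charts are smooth. -/
def Form.SmoothOn {k : ℕ} (η : Form E M F k) (U : Set M) : Prop :=
  ∀ x ∈ U, ContDiffAt ℝ ∞ (η.inChart x) (extChartAt 𝓘(ℝ, E) x x)

/-- The exterior derivative: at `x`, the exterior derivative of the expression of `η` in the
chart at `x`, pulled back under the chart. -/
def Form.d {k : ℕ} (η : Form E M F k) : Form E M F (k + 1) := fun x =>
  (extDeriv (η.inChart x) (extChartAt 𝓘(ℝ, E) x x)).compContinuousLinearMap
    (mfderiv 𝓘(ℝ, E) 𝓘(ℝ, E) (extChartAt 𝓘(ℝ, E) x) x)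

/-- A function regarded as a `0`-form. -/
def Form.ofFun (f : M → F) : Form E M F 0 := fun x =>
  ContinuousAlternatingMap.constOfIsEmpty ℝ (TangentSpace 𝓘(ℝ, E) x) (Fin 0) (f x)

/-- The complex-valued form `c • η` for a real-valued form `η` and a complex number `c`. -/
def Form.complexMul {k : ℕ} (c : ℂ) (η : Form E M ℝ k) : Form E M ℂ k := fun x =>
  c • Complex.ofRealCLM.compContinuousAlternatingMap (η x)

end Forms

/-! ### Čech cochains, the Čech–de Rham double complex, and integral classes -/

section Cech

open TopologicalSpace

variable {ι : Type*}

/-- The intersection `U_{a 0} ∩ ⋯ ∩ U_{a p}`. -/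
def inter {M : Type*} [TopologicalSpace M] (U : ι → Opens M) {p : ℕ} (a : Fin (p + 1) → ι) :
    Set M :=
  ⋂ i, (U (a i) : Set M)

/-- The Čech coboundary `(δc)_{i₀…i_{p+1}} = ∑ₘ (-1)ᵐ c_{i₀…îₘ…i_{p+1}}`.  Cochains with values in
forms or functions are fields on all of `M`, of which only the values of the `a`-component on
`inter U a` are used. -/
def cechδ {A : Type*} [AddCommGroup A] {p : ℕ} (c : (Fin (p + 1) → ι) → A) :
    (Fin (p + 2) → ι) → A :=
  fun a => ∑ m : Fin (p + 2), (-1 : ℤ) ^ (m : ℕ) • c (a ∘ m.succAbove)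

/-- `n` is a Čech `p`-cocycle of the cover `U` with coefficients in the constant sheaf `ℤ`: its
components are locally constant on the intersections, and its coboundary vanishes. -/
structure IsIntCocycle {M : Type*} [TopologicalSpace M] (U : ι → Opens M) {p : ℕ}
    (n : (Fin (p + 1) → ι) → M → ℤ) : Prop where
  locallyConstant : ∀ a, ContinuousOn (n a) (inter U a)
  cocycle : ∀ a, ∀ x ∈ inter U a, cechδ n a x = 0

variable {E : Type*} [NormedAddCommGroup E] [NormedSpace ℝ E]
  {M : Type*} [TopologicalSpace M] [ChartedSpace E M]

/-- The Čech `2`-cochain `c` of locally constant real functions and the `2`-form `Ω` are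
cohomologous in the total complex of the Čech–de Rham double complex `Č^p(U; Ω^q)`, whose
differential is `D = δ + (-1)^p d`: the difference of `(Ω|_{U_i})` in bidegree `(0, 2)` and
`c` in bidegree `(2, 0)` is `D (θ, f)` with `θ` of bidegree `(0, 1)` and `f` of bidegree `(1, 0)`.
This relation is the Čech–de Rham isomorphism. -/
def CechDeRhamCohomologous (U : ι → Opens M) (c : (Fin 3 → ι) → M → ℝ) (Ω : Form E M ℝ 2) :
    Prop :=
  ∃ (θ : (Fin 1 → ι) → Form E M ℝ 1) (f : (Fin 2 → ι) → Form E M ℝ 0),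
    (∀ a, (θ a).SmoothOn (inter U a)) ∧
    (∀ a, (f a).SmoothOn (inter U a)) ∧
    (∀ a, ∀ x ∈ inter U a, (θ a).d x = Ω x) ∧
    (∀ a, ∀ x ∈ inter U a, cechδ θ a x - (f a).d x = 0) ∧
    (∀ a, ∀ x ∈ inter U a, cechδ f a x = -Form.ofFun (E := E) (c a) x)

end Cech

/-- The de Rham class of the closed `2`-form `Ω` is integral: it lies in the image of
`Ȟ²(M; ℤ) → Ȟ²(M; ℝ) ≅ H²_dR(M; ℝ)`, where `ℤ` is embedded in `ℝ` by `k ↦ 2πk`.  Čech cohomology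
is the direct limit over open covers, so a Čech class is given by a cocycle of some open cover. -/
def HasIntegralClass {E : Type*} [NormedAddCommGroup E] [NormedSpace ℝ E]
    {M : Type u} [TopologicalSpace M] [ChartedSpace E M] (Ω : Form E M ℝ 2) : Prop :=
  ∃ (ι : Type u) (U : ι → TopologicalSpace.Opens M), (⨆ i, U i = ⊤) ∧
    ∃ n : (Fin 3 → ι) → M → ℤ, IsIntCocycle U n ∧
      CechDeRhamCohomologous U (fun a x => 2 * Real.pi * n a x) Ω

/-! ### Hermitian line bundles -/

/-- A complex vector bundle is in particular a real vector bundle. -/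
instance vectorBundle_restrictScalars {B : Type*} [TopologicalSpace B] {V : B → Type*}
    [TopologicalSpace (TotalSpace ℂ V)] [∀ x, AddCommGroup (V x)] [∀ x, Module ℂ (V x)]
    [∀ x, TopologicalSpace (V x)] [FiberBundle ℂ V] [VectorBundle ℂ ℂ V] :
    VectorBundle ℝ ℂ V := by
  have hlin : ∀ (e : Trivialization ℂ (TotalSpace.proj : TotalSpace ℂ V → B))
      [MemTrivializationAtlas e], e.IsLinear ℝ := fun e _ =>
    ⟨fun b hb => ⟨(e.linear ℂ hb).map_add, fun c x => by
      have h := (e.linear ℂ hb).map_smul (c : ℂ) x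
      simpa using h⟩⟩
  refine ⟨hlin, fun e e' _ _ => ?_⟩
  have := hlin e
  have := hlin e'
  refine ((ContinuousLinearMap.restrictScalarsL ℂ ℂ ℂ ℝ ℝ).continuous.comp_continuousOn
    (continuousOn_coordChange ℂ e e')).congr fun b hb => ?_
  ext
  simp [Trivialization.coordChangeL_apply, hb]

section Bundles

variable (E : Type*) [NormedAddCommGroup E] [NormedSpace ℝ E]
  (M : Type u) [TopologicalSpace M] [ChartedSpace E M]

/-- A hermitian line bundle over `M`: a smooth complex vector bundle of rank one (the
trivialisations are `ℂ`-linear on fibres, and the transition functions are smooth) together with a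
smooth hermitian structure, conjugate-linear in its first argument. -/
structure HermitianLineBundle where
  Fiber : M → Type v
  [addCommGroup : ∀ x, AddCommGroup (Fiber x)]
  [module : ∀ x, Module ℂ (Fiber x)]
  [topologicalSpace : ∀ x, TopologicalSpace (Fiber x)]
  [topologicalSpaceTotal : TopologicalSpace (TotalSpace ℂ Fiber)]
  [fiberBundle : FiberBundle ℂ Fiber]
  [vectorBundle : VectorBundle ℂ ℂ Fiber]
  [contMDiffVectorBundle : ContMDiffVectorBundle ∞ ℂ Fiber 𝓘(ℝ, E)]
  herm : ∀ x, Fiber x →ₗ⋆[ℂ] Fiber x →ₗ[ℂ] ℂ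
  herm_conj : ∀ x (r s : Fiber x), star (herm x r s) = herm x s r
  herm_pos : ∀ x (s : Fiber x), s ≠ 0 → 0 < (herm x s s).re
  herm_smooth : ∀ r s : Cₛ^∞⟮𝓘(ℝ, E); ℂ, Fiber⟯,
    ContMDiff 𝓘(ℝ, E) 𝓘(ℝ, ℂ) ∞ (fun x => herm x (r x) (s x))

namespace HermitianLineBundle

attribute [instance] addCommGroup module topologicalSpace topologicalSpaceTotal fiberBundle
  vectorBundle contMDiffVectorBundle

variable {E M}

/-- The space `Γ(L)` of smooth global sections of `L`. -/
abbrev Sections (L : HermitianLineBundle.{u, v} E M) : Type _ := Cₛ^∞⟮𝓘(ℝ, E); ℂ, L.Fiber⟯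

/-- The product `f s` of a smooth complex function and a smooth section. -/
def mulSection (L : HermitianLineBundle.{u, v} E M) (f : C^∞⟮𝓘(ℝ, E), M; 𝓘(ℝ, ℂ), ℂ⟯)
    (s : L.Sections) : L.Sections :=
  ⟨fun x => f x • s x, by
    intro x₀
    have hs := (contMDiffAt_section x₀).1 (s.contMDiff x₀)
    refine (contMDiffAt_section x₀).2 ((((contDiff_mul (𝕜 := ℝ) (𝔸 := ℂ)
      (n := ∞)).contMDiff.contMDiffAt.comp x₀
        ((f.contMDiff x₀).prodMk_space hs))).congr_of_eventuallyEq ?_)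
    filter_upwards [(trivializationAt ℂ L.Fiber x₀).open_baseSet.mem_nhds
      (mem_baseSet_trivializationAt ℂ L.Fiber x₀)] with x hx
    exact ((trivializationAt ℂ L.Fiber x₀).linear ℂ hx).map_smul (f x) (s x)⟩

end HermitianLineBundle

variable {E M}

variable (E M) in
/-- The space `𝔛(M; ℝ)` of smooth vector fields. -/
abbrev VectorFields [IsManifold 𝓘(ℝ, E) ∞ M] : Type _ :=
  Cₛ^∞⟮𝓘(ℝ, E); E, (TangentSpace 𝓘(ℝ, E) : M → Type _)⟯

/-- A hermitian connexion on `L`.  For a smooth section `s`, `∇ s` is a smooth `L`-valued `1`-form,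
i.e. an element of `Ω¹(M; ℂ) ⊗ Γ(L)`: `∇ s x v` is an element of the fibre at `x`, for `v` tangent to
`M` at `x`, and `x ↦ ∇ s x (X x)` is a smooth section, denoted `∇_X s`, for every smooth vector
field `X`. -/
structure HermitianConnexion [IsManifold 𝓘(ℝ, E) ∞ M] (L : HermitianLineBundle.{u, v} E M) where
  toFun : L.Sections → ∀ x : M, TangentSpace 𝓘(ℝ, E) x →ₗ[ℝ] L.Fiber x
  smooth : ∀ (s : L.Sections) (X : VectorFields E M),
    ContMDiff 𝓘(ℝ, E) (𝓘(ℝ, E).prod 𝓘(ℝ, ℂ)) ∞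
      (fun x => TotalSpace.mk' ℂ x (toFun s x (X x)))
  map_add : ∀ (r s : L.Sections) x, toFun (r + s) x = toFun r x + toFun s x
  leibniz : ∀ (f : C^∞⟮𝓘(ℝ, E), M; 𝓘(ℝ, ℂ), ℂ⟯) (s : L.Sections) x
    (v : TangentSpace 𝓘(ℝ, E) x),
    toFun (L.mulSection f s) x v = mvfderiv 𝓘(ℝ, E) f x v • s x + f x • toFun s x v
  hermitian : ∀ (r s : L.Sections) x (v : TangentSpace 𝓘(ℝ, E) x),
    mvfderiv 𝓘(ℝ, E) (fun y => L.herm y (r y) (s y)) x v =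
      L.herm x (toFun r x v) (s x) + L.herm x (r x) (toFun s x v)

namespace HermitianConnexion

variable [IsManifold 𝓘(ℝ, E) ∞ M] {L : HermitianLineBundle.{u, v} E M}

/-- The section `∇_X s`. -/
def along (D : HermitianConnexion L) (X : VectorFields E M) (s : L.Sections) : L.Sections :=
  ⟨fun x => D.toFun s x (X x), D.smooth s X⟩

/-- The imaginary `2`-form `K` is the curvature of the connexion `D`:
`K(X, Y) s = ∇_X ∇_Y s - ∇_Y ∇_X s - ∇_{[X, Y]} s` for all smooth `s`, `X`, `Y`. -/
structure HasCurvature (D : HermitianConnexion L) (K : Form E M ℂ 2) : Prop where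
  smooth : K.SmoothOn univ
  imaginary : ∀ x v, (K x v).re = 0
  curvature : ∀ (X Y : VectorFields E M) (s : L.Sections) (x : M),
    K x ![X x, Y x] • s x =
      D.along X (D.along Y s) x - D.along Y (D.along X s) x -
        D.toFun s x (VectorField.mlieBracket 𝓘(ℝ, E) X Y x)

end HermitianConnexion

/-- A hermitian bundle diffeomorphism between hermitian line bundles: a diffeomorphism of the total
spaces over the identity of `M` which is a `ℂ`-linear isometry on every fibre. -/
structure HermitianIso (L : HermitianLineBundle.{u, v} E M)
    (L' : HermitianLineBundle.{u, v'} E M) where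
  toFun : ∀ x, L.Fiber x ≃ₗ[ℂ] L'.Fiber x
  smooth : ContMDiff (𝓘(ℝ, E).prod 𝓘(ℝ, ℂ)) (𝓘(ℝ, E).prod 𝓘(ℝ, ℂ)) ∞
    (fun p : TotalSpace ℂ L.Fiber => TotalSpace.mk' ℂ p.1 (toFun p.1 p.2))
  smooth_symm : ContMDiff (𝓘(ℝ, E).prod 𝓘(ℝ, ℂ)) (𝓘(ℝ, E).prod 𝓘(ℝ, ℂ)) ∞
    (fun p : TotalSpace ℂ L'.Fiber => TotalSpace.mk' ℂ p.1 ((toFun p.1).symm p.2))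
  isometry : ∀ x (r s : L.Fiber x), L'.herm x (toFun x r) (toFun x s) = L.herm x r s

/-- The section `φ ∘ s`. -/
def HermitianIso.mapSection {L : HermitianLineBundle.{u, v} E M}
    {L' : HermitianLineBundle.{u, v'} E M} (φ : HermitianIso L L') (s : L.Sections) :
    L'.Sections :=
  ⟨fun x => φ.toFun x (s x), φ.smooth.comp s.contMDiff⟩

/-- Equivalence of hermitian line bundles with hermitian connexion: there is a hermitian bundle
diffeomorphism `φ` with `φ ∘ ∇_X s = ∇'_X (φ ∘ s)`. -/
def HermitianConnexion.Equivalent [IsManifold 𝓘(ℝ, E) ∞ M] {L : HermitianLineBundle.{u, v} E M}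
    {L' : HermitianLineBundle.{u, v'} E M} (D : HermitianConnexion L)
    (D' : HermitianConnexion L') : Prop :=
  ∃ φ : HermitianIso L L', ∀ (s : L.Sections) (X : VectorFields E M) (x : M),
    φ.mapSection (D.along X s) x = D'.along X (φ.mapSection s) x

end Bundles

end LineBundle

end

/-! Put η = Ω/e. On some open cover, integrality provides potentials θ_i with dθ_i = η, functions
f_ij with df_ij = θ_j - θ_i, and integers n_ijk with f_jk - f_ik + f_ij = -2π n_ijk. The phases g_ij
= exp(-i f_ij) satisfy g_jk g_ij = g_ik because the defect of f lies in 2πℤ, so they glue trivial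
line bundles over the U_i; having modulus one, they preserve the standard hermitian product of ℂ.
Since dg_ij = i(θ_i - θ_j) g_ij, the operators d + iθ_i agree on overlaps. They are hermitian
because iθ_i is imaginary, and their curvature is i dθ_i = (i/e) Ω.

`exists_connexionCocycle` turns the Čech–de Rham data into g and θ; `covariantDerivative_coord` is
the agreement on overlaps; `curvature_connexion` computes the curvature from `mvfderiv_mlieBracket`
and `Form.d_apply_vectorField`, both proved by passing to a chart.
`HermitianConnexion.HasCurvature.of_equivalent` carries the result to every representative of the
class. -/

noncomputable section

namespace LineBundle

open Filter VectorField

/-! ### Vector fields, one-forms and Lie brackets in a chart -/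

section ChartCalculus

variable {E : Type*} [NormedAddCommGroup E] [NormedSpace ℝ E]
  {M : Type*} [TopologicalSpace M] [ChartedSpace E M]
  {F : Type*} [NormedAddCommGroup F] [NormedSpace ℝ F]

theorem extDeriv_oneForm_apply {α : E → E [⋀^Fin 1]→L[ℝ] F} {V W : E → E} {p : E}
    (hα : DifferentiableAt ℝ α p) (hV : DifferentiableAt ℝ V p) (hW : DifferentiableAt ℝ W p) :
    extDeriv α p ![V p, W p] =
      fderiv ℝ (fun y => α y ![W y]) p (V p) - fderiv ℝ (fun y => α y ![V y]) p (W p) -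
        α p ![lieBracket ℝ V W p] := by
  have h : extDeriv α p (![V, W] · p) =
      (∑ i : Fin 2, (-1) ^ i.val • fderiv ℝ (fun x ↦ α x (i.removeNth (![V, W] · x))) p
        (![V, W] i p)) -
        ∑ i : Fin 1, ∑ j ≥ i, (-1) ^ (i + j : ℕ) •
          α p (Matrix.vecCons (lieBracket ℝ (![V, W] i.castSucc) (![V, W] j.succ) p)
            (j.removeNth <| i.castSucc.removeNth (![V, W] · p))) :=
    extDeriv_apply_vectorField hα (by
      intro i
      fin_cases i
      exacts [hV, hW])
  have h0 : (![V, W] · p) = ![V p, W p] := by ext i; fin_cases i <;> rfl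
  have h1 : ∀ y, (0 : Fin 2).removeNth (![V, W] · y) = ![W y] := by
    intro y; ext i; fin_cases i; rfl
  have h2 : ∀ y, (1 : Fin 2).removeNth (![V, W] · y) = ![V y] := by
    intro y; ext i; fin_cases i; rfl
  have h3 : ∀ z : E, Matrix.vecCons z ((0 : Fin 1).removeNth ![W p]) = ![z] := by
    intro z; ext i; fin_cases i; rfl
  rw [h0] at h
  simp only [Fin.sum_univ_two, h1, h2] at h
  rw [h]
  simp only [Fin.val_zero, pow_zero, one_smul, Fin.val_one, pow_one, neg_smul, ← sub_eq_add_neg,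
    Finset.univ_unique, Finset.sum_singleton, Fin.default_eq_zero]
  congr 1
  -- The bracket part of the general formula is a double sum over i ≤ j in `Fin 1`: a single term,
  -- with sign +1.
  rw [show Finset.Ici (0 : Fin 1) = {0} from rfl, Finset.sum_singleton]
  simp only [Fin.val_zero, add_zero, pow_zero, one_smul, Fin.castSucc_zero]
  exact congrArg (α p) (h3 _)

theorem contDiffAt_fderiv_apply {h : E → F} {V : E → E} {p : E} (hh : ContDiffAt ℝ ∞ h p)
    (hV : ContDiffAt ℝ ∞ V p) : ContDiffAt ℝ ∞ (fun y => fderiv ℝ h y (V y)) p :=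
  (hh.fderiv_right (m := ∞) (by simp)).clm_apply hV

theorem contDiffAt_oneForm_apply {α : E → E [⋀^Fin 1]→L[ℝ] F} {V : E → E} {p : E}
    (hα : ContDiffAt ℝ ∞ α p) (hV : ContDiffAt ℝ ∞ V p) :
    ContDiffAt ℝ ∞ (fun y => α y ![V y]) p := by
  have h : (fun y => α y ![V y]) = fun y =>
      (ContinuousAlternatingMap.ofSubsingletonLIE (𝕜 := ℝ) (E := E) (F := F) (0 : Fin 1)).symm
        (α y) (V y) := by
    ext y
    refine congrArg (α y) (funext fun i => ?_)
    fin_cases i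
    rfl
  rw [h]
  exact ((ContinuousAlternatingMap.ofSubsingletonLIE (𝕜 := ℝ) (E := E) (F := F)
    (0 : Fin 1)).symm.contDiff.contDiffAt.comp p hα).clm_apply hV

/-- The expression of a vector field in the preferred chart at `x₀`. -/
def chartField (X : ∀ x : M, TangentSpace 𝓘(ℝ, E) x) (x₀ : M) : E → E :=
  mpullbackWithin 𝓘(ℝ, E) 𝓘(ℝ, E) (extChartAt 𝓘(ℝ, E) x₀).symm X (range 𝓘(ℝ, E))

theorem contDiffAt_chart {u : M → F} {x₀ : M}
    (hu : ContMDiffAt 𝓘(ℝ, E) 𝓘(ℝ, F) ∞ u x₀) :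
    ContDiffAt ℝ ∞ (u ∘ (extChartAt 𝓘(ℝ, E) x₀).symm) (extChartAt 𝓘(ℝ, E) x₀ x₀) := by
  have h := (contMDiffAt_iff.1 hu).2
  rwa [modelWithCornersSelf_coe, range_id, contDiffWithinAt_univ, extChartAt_model_space_eq_id]
    at h

theorem mvfderiv_congr {u w : M → F} {x : M} (h : u =ᶠ[𝓝 x] w) :
    mvfderiv 𝓘(ℝ, E) u x = mvfderiv 𝓘(ℝ, E) w x := by
  ext v
  exact congrArg (fun L : E →L[ℝ] F => L v) (h.mfderiv_eq (I := 𝓘(ℝ, E)) (I' := 𝓘(ℝ, F)))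

theorem contMDiffAt_of_contDiffAt_chart {h : E → F} {u : M → F} {x₀ : M}
    (hh : ContDiffAt ℝ ∞ h (extChartAt 𝓘(ℝ, E) x₀ x₀))
    (hu : u =ᶠ[𝓝 x₀] h ∘ extChartAt 𝓘(ℝ, E) x₀) :
    ContMDiffAt 𝓘(ℝ, E) 𝓘(ℝ, F) ∞ u x₀ :=
  (hh.contMDiffAt.comp x₀ contMDiffAt_extChartAt).congr_of_eventuallyEq hu

theorem eventuallyEq_chart {T : Type*} (u : M → T) {x₀ x : M} (hx : x ∈ (extChartAt 𝓘(ℝ, E) x₀).source) :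
    u =ᶠ[𝓝 x] (u ∘ (extChartAt 𝓘(ℝ, E) x₀).symm) ∘ extChartAt 𝓘(ℝ, E) x₀ := by
  filter_upwards [(isOpen_extChartAt_source (I := 𝓘(ℝ, E)) x₀).mem_nhds hx] with y hy
  exact congrArg u ((extChartAt 𝓘(ℝ, E) x₀).left_inv hy).symm

variable [IsManifold 𝓘(ℝ, E) ∞ M]

/-- A derivative read in a chart. -/
theorem mvfderiv_eq_fderiv_chart {u : M → F} {h : E → F} {x₀ x : M}
    (hx : x ∈ (extChartAt 𝓘(ℝ, E) x₀).source)
    (hh : DifferentiableAt ℝ h (extChartAt 𝓘(ℝ, E) x₀ x))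
    (hu : u =ᶠ[𝓝 x] h ∘ extChartAt 𝓘(ℝ, E) x₀) (v : TangentSpace 𝓘(ℝ, E) x) :
    mvfderiv 𝓘(ℝ, E) u x v = fderiv ℝ h (extChartAt 𝓘(ℝ, E) x₀ x)
      (mfderiv 𝓘(ℝ, E) 𝓘(ℝ, E) (extChartAt 𝓘(ℝ, E) x₀) x v) := by
  rw [mvfderiv_congr hu]
  have hφ : MDifferentiableAt 𝓘(ℝ, E) 𝓘(ℝ, E) (extChartAt 𝓘(ℝ, E) x₀) x :=
    mdifferentiableAt_extChartAt (by simpa using hx)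
  have := mfderiv_comp_apply x (I := 𝓘(ℝ, E)) (I' := 𝓘(ℝ, E)) (I'' := 𝓘(ℝ, F))
    hh.mdifferentiableAt hφ v
  rw [mfderiv_eq_fderiv] at this
  exact this

theorem mfderiv_extChartAt_symm_mfderiv {x₀ x : M}
    (hx : x ∈ (extChartAt 𝓘(ℝ, E) x₀).source) (v : TangentSpace 𝓘(ℝ, E) x) :
    mfderiv 𝓘(ℝ, E) 𝓘(ℝ, E) (extChartAt 𝓘(ℝ, E) x₀).symm (extChartAt 𝓘(ℝ, E) x₀ x)
      (mfderiv 𝓘(ℝ, E) 𝓘(ℝ, E) (extChartAt 𝓘(ℝ, E) x₀) x v) = v := by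
  have h := mfderivWithin_extChartAt_symm_comp_mfderiv_extChartAt' (I := 𝓘(ℝ, E)) hx
  rw [modelWithCornersSelf_coe, range_id, mfderivWithin_univ] at h
  exact congrArg (fun L : E →L[ℝ] E => L v) h

theorem chartField_apply (X : ∀ x : M, TangentSpace 𝓘(ℝ, E) x) {x₀ x : M}
    (hx : x ∈ (extChartAt 𝓘(ℝ, E) x₀).source) :
    chartField X x₀ (extChartAt 𝓘(ℝ, E) x₀ x) =
      mfderiv 𝓘(ℝ, E) 𝓘(ℝ, E) (extChartAt 𝓘(ℝ, E) x₀) x (X x) := by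
  -- `mpullbackWithin` applies the inverse of the derivative of the inverse chart, which is the
  -- derivative of the chart.
  have hinv : (mfderivWithin 𝓘(ℝ, E) 𝓘(ℝ, E) (extChartAt 𝓘(ℝ, E) x₀).symm (range 𝓘(ℝ, E))
      (extChartAt 𝓘(ℝ, E) x₀ x)).inverse =
        mfderiv 𝓘(ℝ, E) 𝓘(ℝ, E) (extChartAt 𝓘(ℝ, E) x₀) x :=
    ContinuousLinearMap.inverse_eq
      (mfderivWithin_extChartAt_symm_comp_mfderiv_extChartAt' (I := 𝓘(ℝ, E)) hx)
      (mfderiv_extChartAt_comp_mfderivWithin_extChartAt_symm' (I := 𝓘(ℝ, E)) hx)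
  have hX : ∀ y, y = x → (show E from X y) = X x := by rintro y rfl; rfl
  rw [chartField, mpullbackWithin_apply, hinv]
  exact congrArg (mfderiv 𝓘(ℝ, E) 𝓘(ℝ, E) (extChartAt 𝓘(ℝ, E) x₀) x)
    (hX _ ((extChartAt 𝓘(ℝ, E) x₀).left_inv hx))

/-- The derivatives of the chart and of its inverse cancel. The identity holds on the whole chart
domain, so both sides can be differentiated at the base point. -/
theorem Form.apply_eq_inChart {k : ℕ} (η : Form E M F k) {x₀ x : M}
    (hx : x ∈ (extChartAt 𝓘(ℝ, E) x₀).source) (w : Fin k → TangentSpace 𝓘(ℝ, E) x) :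
    η x w = η.inChart x₀ (extChartAt 𝓘(ℝ, E) x₀ x)
      (fun i => mfderiv 𝓘(ℝ, E) 𝓘(ℝ, E) (extChartAt 𝓘(ℝ, E) x₀) x (w i)) := by
  -- The chart followed by its inverse returns x only up to a propositional equality, so the two
  -- values of η are compared with both tangent spaces read as E.
  have hη : ∀ y, y = x → (show E [⋀^Fin k]→L[ℝ] F from η y) = η x := by rintro y rfl; rfl
  have h1 := hη _ ((extChartAt 𝓘(ℝ, E) x₀).left_inv hx)
  have h2 : (fun i => mfderiv 𝓘(ℝ, E) 𝓘(ℝ, E) (extChartAt 𝓘(ℝ, E) x₀).symm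
      (extChartAt 𝓘(ℝ, E) x₀ x)
      (mfderiv 𝓘(ℝ, E) 𝓘(ℝ, E) (extChartAt 𝓘(ℝ, E) x₀) x (w i))) = w :=
    funext fun i => mfderiv_extChartAt_symm_mfderiv hx (w i)
  change _ = (show E [⋀^Fin k]→L[ℝ] F from η _) (fun i => mfderiv 𝓘(ℝ, E) 𝓘(ℝ, E)
    (extChartAt 𝓘(ℝ, E) x₀).symm (extChartAt 𝓘(ℝ, E) x₀ x)
      (mfderiv 𝓘(ℝ, E) 𝓘(ℝ, E) (extChartAt 𝓘(ℝ, E) x₀) x (w i)))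
  rw [h1]
  exact congrArg (η x) h2.symm

theorem contDiffAt_chartField [CompleteSpace E] {X : ∀ x : M, TangentSpace 𝓘(ℝ, E) x} {x₀ : M}
    (hX : ContMDiffAt 𝓘(ℝ, E) (𝓘(ℝ, E).prod 𝓘(ℝ, E)) ∞ (fun x => TotalSpace.mk' E x (X x)) x₀) :
    ContDiffAt ℝ ∞ (chartField X x₀) (extChartAt 𝓘(ℝ, E) x₀ x₀) := by
  have h := contMDiffWithinAt_mpullbackWithin_extChartAt_symm (m := ∞) (n := ∞) (s := univ)
    (contMDiffWithinAt_univ.2 hX) uniqueMDiffOn_univ (mem_univ x₀) (by simp)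
  have h2 := contMDiffWithinAt_vectorSpace_iff_contDiffWithinAt.1 h
  refine h2.contDiffAt ?_
  simpa using extChartAt_target_mem_nhds (I := 𝓘(ℝ, E)) x₀

/-- The Lie bracket read in the chart at its base point. -/
theorem mlieBracket_eq_lieBracket_chartField (X Y : ∀ x : M, TangentSpace 𝓘(ℝ, E) x) (x₀ : M) :
    mlieBracket 𝓘(ℝ, E) X Y x₀ =
      lieBracket ℝ (chartField X x₀) (chartField Y x₀) (extChartAt 𝓘(ℝ, E) x₀ x₀) := by
  have h : mlieBracket 𝓘(ℝ, E) X Y x₀ =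
      (mfderiv 𝓘(ℝ, E) 𝓘(ℝ, E) (extChartAt 𝓘(ℝ, E) x₀) x₀).inverse
        (lieBracketWithin ℝ (E := E) (chartField X x₀) (chartField Y x₀)
          ((extChartAt 𝓘(ℝ, E) x₀).symm ⁻¹' univ ∩ range 𝓘(ℝ, E))
          (extChartAt 𝓘(ℝ, E) x₀ x₀)) := rfl
  -- The tangent space at x₀ is identified with E through the preferred chart at x₀, so the
  -- derivative of that chart at x₀ is the identity.
  rw [h, mfderiv_extChartAt_self, preimage_univ, modelWithCornersSelf_coe, range_id, inter_univ,
    lieBracketWithin_univ]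
  exact congrArg (fun L : E →L[ℝ] E => L _) ContinuousLinearMap.inverse_id

theorem chartField_self (X : ∀ x : M, TangentSpace 𝓘(ℝ, E) x) (x₀ : M) :
    chartField X x₀ (extChartAt 𝓘(ℝ, E) x₀ x₀) = X x₀ := by
  rw [chartField_apply X (mem_extChartAt_source x₀), mfderiv_extChartAt_self]
  rfl

/-- The derivative of a smooth function along a vector field, in a chart. -/
theorem eventuallyEq_mvfderiv_vectorField {u : M → F} {x₀ : M}
    (hu : ContMDiffAt 𝓘(ℝ, E) 𝓘(ℝ, F) ∞ u x₀) (X : ∀ x : M, TangentSpace 𝓘(ℝ, E) x) :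
    (fun x => mvfderiv 𝓘(ℝ, E) u x (X x)) =ᶠ[𝓝 x₀]
      (fun y => fderiv ℝ (u ∘ (extChartAt 𝓘(ℝ, E) x₀).symm) y (chartField X x₀ y)) ∘
        extChartAt 𝓘(ℝ, E) x₀ := by
  have h := ((contDiffAt_chart hu).of_le (m := 1) (by simp)).eventually (by simp)
  filter_upwards [(isOpen_extChartAt_source (I := 𝓘(ℝ, E)) x₀).mem_nhds (mem_extChartAt_source x₀),
    (continuousAt_extChartAt (I := 𝓘(ℝ, E)) x₀).eventually h] with x hx hdx
  rw [mvfderiv_eq_fderiv_chart hx (hdx.differentiableAt (by simp)) (eventuallyEq_chart u hx)]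
  simp only [Function.comp_apply, chartField_apply X hx]

theorem Form.eventuallyEq_apply_vectorField (θ : Form E M F 1)
    (X : ∀ x : M, TangentSpace 𝓘(ℝ, E) x) (x₀ : M) :
    (fun x => θ x ![X x]) =ᶠ[𝓝 x₀]
      (fun y => θ.inChart x₀ y ![chartField X x₀ y]) ∘ extChartAt 𝓘(ℝ, E) x₀ := by
  filter_upwards [(isOpen_extChartAt_source (I := 𝓘(ℝ, E)) x₀).mem_nhds
    (mem_extChartAt_source x₀)] with x hx
  rw [Form.apply_eq_inChart θ hx, Function.comp_apply, chartField_apply X hx]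
  congr 1
  ext i
  fin_cases i
  rfl

variable [CompleteSpace E]

theorem contMDiffAt_mvfderiv_vectorField {u : M → F} {x₀ : M}
    (hu : ContMDiffAt 𝓘(ℝ, E) 𝓘(ℝ, F) ∞ u x₀) {X : ∀ x : M, TangentSpace 𝓘(ℝ, E) x}
    (hX : ContMDiffAt 𝓘(ℝ, E) (𝓘(ℝ, E).prod 𝓘(ℝ, E)) ∞ (fun x => TotalSpace.mk' E x (X x)) x₀) :
    ContMDiffAt 𝓘(ℝ, E) 𝓘(ℝ, F) ∞ (fun x => mvfderiv 𝓘(ℝ, E) u x (X x)) x₀ :=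
  contMDiffAt_of_contDiffAt_chart
    (contDiffAt_fderiv_apply (contDiffAt_chart hu) (contDiffAt_chartField hX))
    (eventuallyEq_mvfderiv_vectorField hu X)

theorem Form.contMDiffAt_apply_vectorField {θ : Form E M F 1} {x₀ : M}
    (hθ : ContDiffAt ℝ ∞ (θ.inChart x₀) (extChartAt 𝓘(ℝ, E) x₀ x₀))
    {X : ∀ x : M, TangentSpace 𝓘(ℝ, E) x}
    (hX : ContMDiffAt 𝓘(ℝ, E) (𝓘(ℝ, E).prod 𝓘(ℝ, E)) ∞ (fun x => TotalSpace.mk' E x (X x)) x₀) :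
    ContMDiffAt 𝓘(ℝ, E) 𝓘(ℝ, F) ∞ (fun x => θ x ![X x]) x₀ :=
  contMDiffAt_of_contDiffAt_chart (contDiffAt_oneForm_apply hθ (contDiffAt_chartField hX))
    (θ.eventuallyEq_apply_vectorField X x₀)

/-- `[X, Y] u = X (Y u) - Y (X u)`. -/
theorem mvfderiv_mlieBracket {u : M → F} {x₀ : M}
    (hu : ContMDiffAt 𝓘(ℝ, E) 𝓘(ℝ, F) ∞ u x₀) {X Y : ∀ x : M, TangentSpace 𝓘(ℝ, E) x}
    (hX : ContMDiffAt 𝓘(ℝ, E) (𝓘(ℝ, E).prod 𝓘(ℝ, E)) ∞ (fun x => TotalSpace.mk' E x (X x)) x₀)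
    (hY : ContMDiffAt 𝓘(ℝ, E) (𝓘(ℝ, E).prod 𝓘(ℝ, E)) ∞ (fun x => TotalSpace.mk' E x (Y x)) x₀) :
    mvfderiv 𝓘(ℝ, E) u x₀ (mlieBracket 𝓘(ℝ, E) X Y x₀) =
      mvfderiv 𝓘(ℝ, E) (fun x => mvfderiv 𝓘(ℝ, E) u x (Y x)) x₀ (X x₀) -
        mvfderiv 𝓘(ℝ, E) (fun x => mvfderiv 𝓘(ℝ, E) u x (X x)) x₀ (Y x₀) := by
  have hx := mem_extChartAt_source (I := 𝓘(ℝ, E)) x₀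
  have hu' := (contDiffAt_chart hu)
  have hX' := contDiffAt_chartField hX
  have hY' := contDiffAt_chartField hY
  have hd := (hu'.fderiv_right (m := ∞) (by simp)).differentiableAt (by simp)
  rw [mvfderiv_eq_fderiv_chart hx (hu'.differentiableAt (by simp)) (eventuallyEq_chart u hx),
    mvfderiv_eq_fderiv_chart hx ((contDiffAt_fderiv_apply hu' hY').differentiableAt (by simp))
      (eventuallyEq_mvfderiv_vectorField hu Y),
    mvfderiv_eq_fderiv_chart hx ((contDiffAt_fderiv_apply hu' hX').differentiableAt (by simp))
      (eventuallyEq_mvfderiv_vectorField hu X), ← chartField_apply X hx, ← chartField_apply Y hx,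
    mfderiv_extChartAt_self, mlieBracket_eq_lieBracket_chartField,
    fderiv_clm_apply hd (hY'.differentiableAt (by simp)),
    fderiv_clm_apply hd (hX'.differentiableAt (by simp))]
  have h2 : minSmoothness ℝ 2 ≤ ∞ := by
    rw [minSmoothness_of_isRCLikeNormedField]
    exact ENat.LEInfty.out
  -- Symmetry of the second derivative cancels u''(X, Y) against u''(Y, X); the first-order terms
  -- left over are u' applied to the bracket.
  have hsymm := (hu'.isSymmSndFDerivAt h2).eq (chartField X x₀ (extChartAt 𝓘(ℝ, E) x₀ x₀))
    (chartField Y x₀ (extChartAt 𝓘(ℝ, E) x₀ x₀))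
  simp only [add_apply, ContinuousLinearMap.comp_apply,
    ContinuousLinearMap.flip_apply, hsymm, add_sub_add_right_eq_sub, ← map_sub]
  rfl

/-- `dθ(X, Y) = X (θ Y) - Y (θ X) - θ [X, Y]`. -/
theorem Form.d_apply_vectorField {θ : Form E M F 1} {x₀ : M}
    (hθ : ContDiffAt ℝ ∞ (θ.inChart x₀) (extChartAt 𝓘(ℝ, E) x₀ x₀))
    {X Y : ∀ x : M, TangentSpace 𝓘(ℝ, E) x}
    (hX : ContMDiffAt 𝓘(ℝ, E) (𝓘(ℝ, E).prod 𝓘(ℝ, E)) ∞ (fun x => TotalSpace.mk' E x (X x)) x₀)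
    (hY : ContMDiffAt 𝓘(ℝ, E) (𝓘(ℝ, E).prod 𝓘(ℝ, E)) ∞ (fun x => TotalSpace.mk' E x (Y x)) x₀) :
    θ.d x₀ ![X x₀, Y x₀] =
      mvfderiv 𝓘(ℝ, E) (fun x => θ x ![Y x]) x₀ (X x₀) -
        mvfderiv 𝓘(ℝ, E) (fun x => θ x ![X x]) x₀ (Y x₀) -
        θ x₀ ![mlieBracket 𝓘(ℝ, E) X Y x₀] := by
  have hx := mem_extChartAt_source (I := 𝓘(ℝ, E)) x₀
  have hX' := contDiffAt_chartField hX
  have hY' := contDiffAt_chartField hY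
  rw [mvfderiv_eq_fderiv_chart hx ((contDiffAt_oneForm_apply hθ hY').differentiableAt (by simp))
      (θ.eventuallyEq_apply_vectorField Y x₀),
    mvfderiv_eq_fderiv_chart hx ((contDiffAt_oneForm_apply hθ hX').differentiableAt (by simp))
      (θ.eventuallyEq_apply_vectorField X x₀), ← chartField_apply X hx, ← chartField_apply Y hx,
    mlieBracket_eq_lieBracket_chartField, θ.apply_eq_inChart hx]
  rw [mfderiv_extChartAt_self, ← chartField_self X, ← chartField_self Y]
  refine Eq.trans ?_ ((extDeriv_oneForm_apply (hθ.differentiableAt (by simp))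
    (hX'.differentiableAt (by simp)) (hY'.differentiableAt (by simp))).trans ?_)
  · rw [Form.d, mfderiv_extChartAt_self]
    rfl
  · rfl

end ChartCalculus

/-! ### Differentiation rules on the manifold, and zero-forms -/

section Calculus

variable {E : Type*} [NormedAddCommGroup E] [NormedSpace ℝ E]
  {M : Type*} [TopologicalSpace M] [ChartedSpace E M]
  {F : Type*} [NormedAddCommGroup F] [NormedSpace ℝ F]
  {F' : Type*} [NormedAddCommGroup F'] [NormedSpace ℝ F']

theorem Form.oneForm_add (θ : Form E M F 1) {x : M} (v w : TangentSpace 𝓘(ℝ, E) x) :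
    θ x ![v + w] = θ x ![v] + θ x ![w] := by
  have h : ∀ z : TangentSpace 𝓘(ℝ, E) x, Function.update ![v] 0 z = ![z] := by
    intro z; ext i; fin_cases i; rfl
  simpa only [h] using (θ x).map_update_add ![v] 0 v w

theorem Form.oneForm_smul (θ : Form E M F 1) {x : M} (c : ℝ) (v : TangentSpace 𝓘(ℝ, E) x) :
    θ x ![c • v] = c • θ x ![v] := by
  have h : ∀ z : TangentSpace 𝓘(ℝ, E) x, Function.update ![v] 0 z = ![z] := by
    intro z; ext i; fin_cases i; rfl
  simpa only [h] using (θ x).map_update_smul ![v] 0 c v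

theorem mvfderiv_clm_comp (L : F →L[ℝ] F') {u : M → F} {x : M}
    (hu : ContMDiffAt 𝓘(ℝ, E) 𝓘(ℝ, F) ∞ u x) (v : TangentSpace 𝓘(ℝ, E) x) :
    mvfderiv 𝓘(ℝ, E) (fun y => L (u y)) x v = L (mvfderiv 𝓘(ℝ, E) u x v) := by
  have h := mfderiv_comp_apply x (I := 𝓘(ℝ, E)) (I' := 𝓘(ℝ, F)) (I'' := 𝓘(ℝ, F')) (g := L)
    L.differentiableAt.mdifferentiableAt (hu.mdifferentiableAt (by simp)) v
  rw [mfderiv_eq_fderiv, ContinuousLinearMap.fderiv] at h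
  exact h

theorem contMDiffAt_clm_comp (L : F →L[ℝ] F') {u : M → F} {x : M}
    (hu : ContMDiffAt 𝓘(ℝ, E) 𝓘(ℝ, F) ∞ u x) :
    ContMDiffAt 𝓘(ℝ, E) 𝓘(ℝ, F') ∞ (fun y => L (u y)) x :=
  L.contDiff.contMDiff.contMDiffAt.comp x hu

theorem mvfderiv_fun_add {a b : M → F} {x : M}
    (ha : MDifferentiableAt 𝓘(ℝ, E) 𝓘(ℝ, F) a x) (hb : MDifferentiableAt 𝓘(ℝ, E) 𝓘(ℝ, F) b x) :
    mvfderiv 𝓘(ℝ, E) (fun y => a y + b y) x = mvfderiv 𝓘(ℝ, E) a x + mvfderiv 𝓘(ℝ, E) b x :=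
  mvfderiv_add ha hb

theorem mvfderiv_complex_mul {a b : M → ℂ} {x : M}
    (ha : ContMDiffAt 𝓘(ℝ, E) 𝓘(ℝ, ℂ) ∞ a x) (hb : ContMDiffAt 𝓘(ℝ, E) 𝓘(ℝ, ℂ) ∞ b x)
    (v : TangentSpace 𝓘(ℝ, E) x) :
    mvfderiv 𝓘(ℝ, E) (fun y => a y * b y) x v =
      mvfderiv 𝓘(ℝ, E) a x v * b x + a x * mvfderiv 𝓘(ℝ, E) b x v := by
  have h := ((ha.mdifferentiableAt (by simp)).hasMFDerivAt.mul
    (hb.mdifferentiableAt (by simp)).hasMFDerivAt).mfderiv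
  have h2 := congrArg (fun L : E →L[ℝ] ℂ => L v) h
  refine h2.trans ?_
  change a x * mvfderiv 𝓘(ℝ, E) b x v + b x * mvfderiv 𝓘(ℝ, E) a x v = _
  ring

theorem contMDiffAt_complex_mul {a b : M → ℂ} {x : M}
    (ha : ContMDiffAt 𝓘(ℝ, E) 𝓘(ℝ, ℂ) ∞ a x) (hb : ContMDiffAt 𝓘(ℝ, E) 𝓘(ℝ, ℂ) ∞ b x) :
    ContMDiffAt 𝓘(ℝ, E) 𝓘(ℝ, ℂ) ∞ (fun y => a y * b y) x :=
  (contDiff_mul (𝕜 := ℝ) (𝔸 := ℂ) (n := ∞)).contMDiff.contMDiffAt.comp x (ha.prodMk_space hb)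

theorem Form.smoothOn_complexMul {k : ℕ} {η : Form E M ℝ k} {U : Set M} (hη : η.SmoothOn U)
    (c : ℂ) : (η.complexMul c).SmoothOn U := by
  intro x hx
  have h : (η.complexMul c).inChart x = fun p =>
      (c • ContinuousLinearMap.compContinuousAlternatingMapCLM ℝ E ℝ ℂ (Fin k) Complex.ofRealCLM)
        (η.inChart x p) := by
    ext p w
    rfl
  rw [h]
  exact ContDiffAt.comp _ (ContinuousLinearMap.contDiff _).contDiffAt (hη x hx)

variable [IsManifold 𝓘(ℝ, E) ∞ M]

theorem contMDiffAt_zeroForm {η : Form E M F 0} {x : M}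
    (hη : ContDiffAt ℝ ∞ (η.inChart x) (extChartAt 𝓘(ℝ, E) x x)) :
    ContMDiffAt 𝓘(ℝ, E) 𝓘(ℝ, F) ∞ (fun y => η y ![]) x := by
  refine contMDiffAt_of_contDiffAt_chart (h := fun p =>
    (ContinuousAlternatingMap.constOfIsEmptyLIE ℝ E F (Fin 0)).symm (η.inChart x p))
    ((ContinuousAlternatingMap.constOfIsEmptyLIE ℝ E F (Fin 0)).symm.contDiff.contDiffAt.comp _ hη)
    ?_
  filter_upwards [(isOpen_extChartAt_source (I := 𝓘(ℝ, E)) x).mem_nhds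
    (mem_extChartAt_source x)] with y hy
  rw [Form.apply_eq_inChart η hy]
  exact congrArg (η.inChart x _) (Subsingleton.elim _ _)

theorem Form.d_zeroForm_apply {η : Form E M F 0} {x : M}
    (hη : ContDiffAt ℝ ∞ (η.inChart x) (extChartAt 𝓘(ℝ, E) x x)) (v : TangentSpace 𝓘(ℝ, E) x) :
    η.d x ![v] = mvfderiv 𝓘(ℝ, E) (fun y => η y ![]) x v := by
  have hx := mem_extChartAt_source (I := 𝓘(ℝ, E)) x
  have hd : DifferentiableAt ℝ (η.inChart x) (extChartAt 𝓘(ℝ, E) x x) :=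
    hη.differentiableAt (by simp)
  have h : (fun y => η y ![]) =ᶠ[𝓝 x]
      (fun p => η.inChart x p ![]) ∘ extChartAt 𝓘(ℝ, E) x := by
    filter_upwards [(isOpen_extChartAt_source (I := 𝓘(ℝ, E)) x).mem_nhds hx] with y hy
    rw [Form.apply_eq_inChart η hy]
    exact congrArg (η.inChart x _) (Subsingleton.elim _ _)
  have hd' : DifferentiableAt ℝ (fun p => η.inChart x p ![]) (extChartAt 𝓘(ℝ, E) x x) := by
    have h0 : (fun p => η.inChart x p ![]) = fun p =>
        (ContinuousAlternatingMap.constOfIsEmptyLIE ℝ E F (Fin 0)).symm (η.inChart x p) := by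
      ext p
      exact congrArg (η.inChart x p) (Subsingleton.elim _ _)
    rw [h0]
    exact (ContinuousAlternatingMap.constOfIsEmptyLIE ℝ E F
      (Fin 0)).symm.differentiable.differentiableAt.comp _ hd
  rw [mvfderiv_eq_fderiv_chart hx hd' h, mfderiv_extChartAt_self]
  -- In degree zero the alternating sum defining the exterior derivative has one term, with sign +1:
  -- the ordinary derivative.
  have h2 := extDeriv_apply hd ![v]
  rw [Fin.sum_univ_one] at h2
  refine Eq.trans ?_ (h2.trans ?_)
  · rw [Form.d, mfderiv_extChartAt_self]
    rfl
  · have h3 : (0 : Fin 1).removeNth (α := fun _ => E) ![v] = ![] := Subsingleton.elim _ _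
    rw [Fin.val_zero, pow_zero, one_smul]
    change fderiv ℝ (fun p => η.inChart x p ((0 : Fin 1).removeNth (α := fun _ => E) ![v])) _ _ = _
    rw [h3]
    rfl

end Calculus

/-! ### The hermitian line bundle glued from a cocycle -/

/-- A smooth `U(1)`-valued cocycle `g` of a cover `U`, where `g i j` passes from the `i`-th to the
`j`-th trivialisation, with local potentials `θ` of a hermitian connexion `d + iθ`. -/
structure ConnexionCocycle (E : Type*) [NormedAddCommGroup E] [NormedSpace ℝ E]
    {M : Type u} [TopologicalSpace M] [ChartedSpace E M] {ι : Type v}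
    (U : ι → TopologicalSpace.Opens M) where
  g : ι → ι → M → ℂ
  θ : ι → Form E M ℝ 1
  indexAt : M → ι
  mem_indexAt : ∀ x, x ∈ U (indexAt x)
  g_smooth : ∀ i j x, x ∈ U i → x ∈ U j → ContMDiffAt 𝓘(ℝ, E) 𝓘(ℝ, ℂ) ∞ (g i j) x
  θ_smooth : ∀ i, (θ i).SmoothOn (U i)
  g_star : ∀ i j x, x ∈ U i → x ∈ U j → star (g i j x) * g i j x = 1
  g_self : ∀ i x, x ∈ U i → g i i x = 1
  g_comp : ∀ i j k x, x ∈ U i → x ∈ U j → x ∈ U k → g j k x * g i j x = g i k x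
  mvfderiv_g : ∀ i j x, x ∈ U i → x ∈ U j → ∀ v : TangentSpace 𝓘(ℝ, E) x,
    mvfderiv 𝓘(ℝ, E) (g i j) x v =
      Complex.I * ((θ i x ![v] : ℝ) - (θ j x ![v] : ℝ)) * g i j x

namespace ConnexionCocycle

variable {E : Type*} [NormedAddCommGroup E] [NormedSpace ℝ E]
  {M : Type u} [TopologicalSpace M] [ChartedSpace E M] {ι : Type v}
  {U : ι → TopologicalSpace.Opens M} (C : ConnexionCocycle E U)

/-- The vector bundle core defined by the transition functions. -/
def core : VectorBundleCore ℂ M ℂ ι where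
  baseSet i := U i
  isOpen_baseSet i := (U i).isOpen
  indexAt := C.indexAt
  mem_baseSet_at := C.mem_indexAt
  coordChange i j x := ContinuousLinearMap.mul ℂ ℂ (C.g i j x)
  coordChange_self i x hx v := by simp [C.g_self i x hx]
  continuousOn_coordChange i j x hx :=
    ((ContinuousLinearMap.mul ℂ ℂ).continuous.continuousAt.comp
      (C.g_smooth i j x hx.1 hx.2).continuousAt).continuousWithinAt
  coordChange_comp i j k x hx v := by
    simp [← C.g_comp i j k x hx.1.1 hx.1.2 hx.2, mul_assoc]

instance contMDiffVectorBundle_core : ContMDiffVectorBundle ∞ ℂ C.core.Fiber 𝓘(ℝ, E) where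
  contMDiffOn_coordChangeL := by
    rintro - - ⟨i, rfl⟩ ⟨j, rfl⟩ x hx
    have h : ContMDiffAt 𝓘(ℝ, E) 𝓘(ℝ, ℂ →L[ℝ] ℂ) ∞
        (fun y => ContinuousLinearMap.mul ℝ ℂ (C.g i j y)) x :=
      contMDiffAt_clm_comp (ContinuousLinearMap.mul ℝ ℂ) (C.g_smooth i j x hx.1 hx.2)
    refine h.contMDiffWithinAt.congr_of_mem (fun y hy => ?_) hx
    ext1 v
    have : MemTrivializationAtlas (C.core.localTriv i) := ⟨i, rfl⟩
    have : MemTrivializationAtlas (C.core.localTriv j) := ⟨j, rfl⟩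
    have hi : (C.core.localTriv i).IsLinear ℝ := VectorBundle.trivialization_linear' (F := ℂ) _
    have hj : (C.core.localTriv j).IsLinear ℝ := VectorBundle.trivialization_linear' (F := ℂ) _
    exact (Trivialization.coordChangeL_apply' (R := ℝ) (C.core.localTriv i) (C.core.localTriv j)
      -- Each local trivialisation reaches the fibre through `indexAt y`, so the change from i to j
      -- is a product of two transition functions, merged by the cocycle identity.
      hy v).trans (show C.g (C.indexAt y) j y * (C.g i (C.indexAt y) y * v) = C.g i j y * v by
        rw [← mul_assoc, C.g_comp i (C.indexAt y) j y hy.1 (C.mem_indexAt y) hy.2])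

/-- The value of a fibre element in the trivialisation with index `indexAt x`. -/
def val (x : M) : C.core.Fiber x ≃ₗ[ℂ] ℂ := LinearEquiv.refl ℂ ℂ

theorem val_symm_real_smul {x : M} (c : ℝ) (z : ℂ) :
    c • ((C.val x).symm z : C.core.Fiber x) = (C.val x).symm (c * z) := rfl

/-- The coordinate of a section in the `i`-th trivialisation. -/
def coord (i : ι) (s : ∀ x, C.core.Fiber x) (x : M) : ℂ :=
  C.g (C.indexAt x) i x * C.val x (s x)

/-- The standard hermitian product of `ℂ` on the fibres. -/
def herm (x : M) : C.core.Fiber x →ₗ⋆[ℂ] C.core.Fiber x →ₗ[ℂ] ℂ :=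
  (innerₛₗ ℂ : ℂ →ₗ⋆[ℂ] ℂ →ₗ[ℂ] ℂ)

theorem herm_apply (x : M) (r s : C.core.Fiber x) :
    C.herm x r s = star (C.val x r) * C.val x s := by
  change inner ℂ (C.val x r) (C.val x s) = _
  rw [RCLike.inner_apply, mul_comm]
  rfl


variable {C}

theorem coord_indexAt (s : ∀ x, C.core.Fiber x) (x : M) :
    C.coord (C.indexAt x) s x = C.val x (s x) := by
  rw [coord, C.g_self _ x (C.mem_indexAt x), one_mul]

theorem coord_change (s : ∀ x, C.core.Fiber x) {i j : ι} {x : M} (hi : x ∈ U i) (hj : x ∈ U j) :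
    C.coord j s x = C.g i j x * C.coord i s x := by
  rw [coord, coord, ← mul_assoc, C.g_comp _ i j x (C.mem_indexAt x) hi hj]

/-- Transition functions have modulus one, so any trivialisation computes the product. A fixed i can
thus be used near a point, whereas `indexAt` may jump from point to point; this is what makes the
product differentiable in practice. -/
theorem star_coord_mul_coord (r s : ∀ x, C.core.Fiber x) {i : ι} {x : M} (hi : x ∈ U i) :
    star (C.coord i r x) * C.coord i s x = C.herm x (r x) (s x) := by
  rw [herm_apply, coord, coord, star_mul']
  linear_combination (star (C.val x (r x)) * C.val x (s x)) *
    C.g_star _ i x (C.mem_indexAt x) hi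

/-- Smoothness at x is by definition tested in the trivialisation `indexAt x`; multiplication by a
smooth transition function moves the test to any other index. -/
theorem contMDiffAt_section_iff (s : ∀ x, C.core.Fiber x) {i : ι} {x : M} (hi : x ∈ U i) :
    ContMDiffAt 𝓘(ℝ, E) (𝓘(ℝ, E).prod 𝓘(ℝ, ℂ)) ∞ (fun y => TotalSpace.mk' ℂ y (s y)) x ↔
      ContMDiffAt 𝓘(ℝ, E) 𝓘(ℝ, ℂ) ∞ (C.coord i s) x := by
  have key : ∀ {i j : ι}, x ∈ U i → x ∈ U j → ContMDiffAt 𝓘(ℝ, E) 𝓘(ℝ, ℂ) ∞ (C.coord i s) x →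
      ContMDiffAt 𝓘(ℝ, E) 𝓘(ℝ, ℂ) ∞ (C.coord j s) x := by
    intro i j hi hj h
    refine (contMDiffAt_complex_mul (C.g_smooth i j x hi hj) h).congr_of_eventuallyEq ?_
    filter_upwards [(U i).isOpen.mem_nhds hi, (U j).isOpen.mem_nhds hj] with y hyi hyj
    exact coord_change s hyi hyj
  rw [contMDiffAt_section]
  exact ⟨key (C.mem_indexAt x) hi, key hi (C.mem_indexAt x)⟩

variable (C)

/-- The hermitian line bundle glued by the cocycle. -/
abbrev lineBundle : HermitianLineBundle.{u, 0} E M where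
  Fiber := C.core.Fiber
  herm := C.herm
  herm_conj x r s := by
    rw [herm_apply, herm_apply, star_mul', star_star, mul_comm]
  herm_pos x s hs := by
    rw [herm_apply]
    have h : 0 < Complex.normSq (C.val x s) := Complex.normSq_pos.2 ((C.val x).map_ne_zero_iff.2 hs)
    have h2 : star (C.val x s) * C.val x s = (Complex.normSq (C.val x s) : ℂ) :=
      Complex.normSq_eq_conj_mul_self.symm
    rwa [h2, Complex.ofReal_re]
  herm_smooth r s x := by
    have hi := C.mem_indexAt x
    refine (contMDiffAt_complex_mul (contMDiffAt_clm_comp Complex.conjCLE.toContinuousLinearMap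
      ((contMDiffAt_section_iff _ hi).1 (r.contMDiff x)))
      ((contMDiffAt_section_iff _ hi).1 (s.contMDiff x))).congr_of_eventuallyEq ?_
    filter_upwards [(U _).isOpen.mem_nhds hi] with y hy
    exact (star_coord_mul_coord _ _ hy).symm

variable {C}

theorem contMDiffAt_coord (s : C.lineBundle.Sections) {i : ι} {x : M} (hi : x ∈ U i) :
    ContMDiffAt 𝓘(ℝ, E) 𝓘(ℝ, ℂ) ∞ (C.coord i s) x :=
  (contMDiffAt_section_iff _ hi).1 (s.contMDiff x)

variable (C) in
/-- The covariant derivative `ds + iθs` at `x`, in the trivialisation with index `indexAt x`. -/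
def covariantDerivative (s : C.lineBundle.Sections) (x : M) :
    TangentSpace 𝓘(ℝ, E) x →ₗ[ℝ] C.lineBundle.Fiber x where
  toFun v := (C.val x).symm (mvfderiv 𝓘(ℝ, E) (C.coord (C.indexAt x) s) x v +
    Complex.I * (C.θ (C.indexAt x) x ![v] : ℝ) * C.val x (s x))
  map_add' v w := by
    refine (congrArg (C.val x).symm ?_).trans (map_add (C.val x).symm _ _)
    rw [map_add, Form.oneForm_add]
    push_cast
    ring
  map_smul' c v := by
    rw [RingHom.id_apply, val_symm_real_smul, map_smul, Form.oneForm_smul]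
    congr 1
    rw [Complex.real_smul, smul_eq_mul]
    push_cast
    ring

theorem val_covariantDerivative (s : C.lineBundle.Sections) (x : M) (v : TangentSpace 𝓘(ℝ, E) x) :
    C.val x (C.covariantDerivative s x v) = mvfderiv 𝓘(ℝ, E) (C.coord (C.indexAt x) s) x v +
      Complex.I * (C.θ (C.indexAt x) x ![v] : ℝ) * C.val x (s x) := rfl

/-- The condition `mvfderiv_g` is exactly what makes this work: the derivative of g_ij in the
product rule replaces iθ_i by iθ_j. So the pointwise definition, with its varying index, can be read
in one fixed trivialisation. -/
theorem covariantDerivative_coord (s : C.lineBundle.Sections) {i : ι} {x : M} (hi : x ∈ U i)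
    (v : TangentSpace 𝓘(ℝ, E) x) :
    C.g (C.indexAt x) i x * C.val x (C.covariantDerivative s x v) =
      mvfderiv 𝓘(ℝ, E) (C.coord i s) x v +
        Complex.I * (C.θ i x ![v] : ℝ) * C.coord i s x := by
  have hx := C.mem_indexAt x
  have h : C.coord i s =ᶠ[𝓝 x] fun y => C.g (C.indexAt x) i y * C.coord (C.indexAt x) s y := by
    filter_upwards [(U _).isOpen.mem_nhds hx, (U i).isOpen.mem_nhds hi] with y hy hyi
    exact coord_change s hy hyi
  rw [mvfderiv_congr h, mvfderiv_complex_mul (C.g_smooth _ i x hx hi) (contMDiffAt_coord s hx),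
    C.mvfderiv_g _ i x hx hi, coord_change s hx hi, coord_indexAt,
    val_covariantDerivative]
  ring

end ConnexionCocycle

/-! ### The hermitian connexion and its curvature -/

namespace ConnexionCocycle

variable {E : Type*} [NormedAddCommGroup E] [NormedSpace ℝ E]
  {M : Type u} [TopologicalSpace M] [ChartedSpace E M] {ι : Type v}
  {U : ι → TopologicalSpace.Opens M} {C : ConnexionCocycle E U}

theorem mvfderiv_coord_mulSection (f : C^∞⟮𝓘(ℝ, E), M; 𝓘(ℝ, ℂ), ℂ⟯) (s : C.lineBundle.Sections)
    {i : ι} {x : M} (hi : x ∈ U i) (v : TangentSpace 𝓘(ℝ, E) x) :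
    mvfderiv 𝓘(ℝ, E) (C.coord i (C.lineBundle.mulSection f s)) x v =
      mvfderiv 𝓘(ℝ, E) f x v * C.coord i s x + f x * mvfderiv 𝓘(ℝ, E) (C.coord i s) x v := by
  have h : C.coord i (C.lineBundle.mulSection f s) = fun y => f y * C.coord i s y :=
    funext fun y => mul_left_comm _ (f y) _
  rw [h, mvfderiv_complex_mul (f.contMDiff x) (contMDiffAt_coord s hi)]

theorem mvfderiv_herm (r s : C.lineBundle.Sections) {i : ι} {x : M} (hi : x ∈ U i)
    (v : TangentSpace 𝓘(ℝ, E) x) :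
    mvfderiv 𝓘(ℝ, E) (fun y => C.herm y (r y) (s y)) x v =
      star (mvfderiv 𝓘(ℝ, E) (C.coord i r) x v) * C.coord i s x +
        star (C.coord i r x) * mvfderiv 𝓘(ℝ, E) (C.coord i s) x v := by
  have h : (fun y => C.herm y (r y) (s y)) =ᶠ[𝓝 x]
      fun y => Complex.conjCLE.toContinuousLinearMap (C.coord i r y) * C.coord i s y := by
    filter_upwards [(U i).isOpen.mem_nhds hi] with y hy
    exact (star_coord_mul_coord _ _ hy).symm
  rw [mvfderiv_congr h, mvfderiv_complex_mul (contMDiffAt_clm_comp _ (contMDiffAt_coord r hi))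
    (contMDiffAt_coord s hi), mvfderiv_clm_comp _ (contMDiffAt_coord r hi)]
  rfl

variable [IsManifold 𝓘(ℝ, E) ∞ M]

/-- Valid on a neighbourhood with i fixed, so that the covariant derivative can be differentiated a
second time. -/
theorem coord_covariantDerivative (s : C.lineBundle.Sections) (X : VectorFields E M) {i : ι}
    {x : M} (hi : x ∈ U i) :
    C.coord i (fun y => C.covariantDerivative s y (X y)) =ᶠ[𝓝 x]
      fun y => mvfderiv 𝓘(ℝ, E) (C.coord i s) y (X y) +
        Complex.I * (C.θ i y ![X y] : ℝ) * C.coord i s y := by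
  filter_upwards [(U i).isOpen.mem_nhds hi] with y hy
  exact covariantDerivative_coord s hy (X y)

variable [CompleteSpace E]

theorem contMDiffAt_potential_apply (X : VectorFields E M) {i : ι} {x : M} (hi : x ∈ U i) :
    ContMDiffAt 𝓘(ℝ, E) 𝓘(ℝ, ℝ) ∞ (fun y => C.θ i y ![X y]) x :=
  Form.contMDiffAt_apply_vectorField (C.θ_smooth i x hi) (X.contMDiff x)

theorem contMDiffAt_mul_potential_apply (X : VectorFields E M) {i : ι} {x : M} (hi : x ∈ U i) :
    ContMDiffAt 𝓘(ℝ, E) 𝓘(ℝ, ℂ) ∞ (fun y => Complex.I * (C.θ i y ![X y] : ℝ)) x :=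
  contMDiffAt_complex_mul contMDiffAt_const
    (contMDiffAt_clm_comp Complex.ofRealCLM (contMDiffAt_potential_apply X hi))

theorem mvfderiv_mul_potential_apply (X : VectorFields E M) {i : ι} {x : M} (hi : x ∈ U i)
    (v : TangentSpace 𝓘(ℝ, E) x) :
    mvfderiv 𝓘(ℝ, E) (fun y => Complex.I * (C.θ i y ![X y] : ℝ)) x v =
      Complex.I * (mvfderiv 𝓘(ℝ, E) (fun y => C.θ i y ![X y]) x v : ℝ) :=
  mvfderiv_clm_comp ((ContinuousLinearMap.mul ℝ ℂ Complex.I).comp Complex.ofRealCLM)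
    (contMDiffAt_potential_apply X hi) v

theorem contMDiffAt_covariantDerivative (s : C.lineBundle.Sections) (X : VectorFields E M)
    {i : ι} {x : M} (hi : x ∈ U i) :
    ContMDiffAt 𝓘(ℝ, E) 𝓘(ℝ, ℂ) ∞ (fun y => mvfderiv 𝓘(ℝ, E) (C.coord i s) y (X y) +
        Complex.I * (C.θ i y ![X y] : ℝ) * C.coord i s y) x :=
  (contMDiffAt_mvfderiv_vectorField (contMDiffAt_coord s hi) (X.contMDiff x)).add
    (contMDiffAt_complex_mul (contMDiffAt_mul_potential_apply X hi) (contMDiffAt_coord s hi))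

variable (C) in
/-- The hermitian connexion with local potentials `iθ`. -/
def connexion : HermitianConnexion C.lineBundle where
  toFun := C.covariantDerivative
  smooth s X x :=
    (contMDiffAt_section_iff _ (C.mem_indexAt x)).2
      ((contMDiffAt_covariantDerivative s X (C.mem_indexAt x)).congr_of_eventuallyEq
        (coord_covariantDerivative s X (C.mem_indexAt x)))
  map_add r s x := by
    ext v
    have h : C.coord (C.indexAt x) (r + s : C.lineBundle.Sections) = fun y =>
        C.coord (C.indexAt x) r y + C.coord (C.indexAt x) s y :=
      funext fun y => mul_add _ _ _
    apply (C.val x).injective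
    refine Eq.trans ?_ (map_add (C.val x) (C.covariantDerivative r x v)
      (C.covariantDerivative s x v)).symm
    rw [val_covariantDerivative, val_covariantDerivative, val_covariantDerivative, h,
      mvfderiv_fun_add ((contMDiffAt_coord r (C.mem_indexAt x)).mdifferentiableAt (by simp))
        ((contMDiffAt_coord s (C.mem_indexAt x)).mdifferentiableAt (by simp)), add_apply]
    change _ + _ * (C.val x (r x) + C.val x (s x)) = _
    ring
  leibniz f s x v := by
    apply (C.val x).injective
    rw [val_covariantDerivative, mvfderiv_coord_mulSection f s (C.mem_indexAt x), coord_indexAt]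
    change _ = mvfderiv 𝓘(ℝ, E) f x v * C.val x (s x) + f x * C.val x (C.covariantDerivative s x v)
    rw [val_covariantDerivative]
    change _ + _ * (f x * C.val x (s x)) = _
    ring
  hermitian r s x v := by
    change _ = C.herm x _ _ + C.herm x _ _
    refine (mvfderiv_herm r s (C.mem_indexAt x) v).trans ?_
    rw [herm_apply, herm_apply, val_covariantDerivative, val_covariantDerivative, coord_indexAt,
      coord_indexAt, star_add, star_mul', star_mul']
    -- As iθ is imaginary, its contributions from the two arguments cancel.
    have h1 : star Complex.I = -Complex.I := Complex.conj_I
    have h2 : ∀ t : ℝ, star (t : ℂ) = t := Complex.conj_ofReal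
    rw [h1, h2]
    ring

/-- The curvature of the connexion `d + iθ` is `i dθ`. -/
theorem curvature_connexion (X Y : VectorFields E M) (s : C.lineBundle.Sections) (x : M) :
    (Complex.I * ((C.θ (C.indexAt x)).d x ![X x, Y x] : ℝ)) • s x =
      C.connexion.along X (C.connexion.along Y s) x -
        C.connexion.along Y (C.connexion.along X s) x -
          C.connexion.toFun s x (mlieBracket 𝓘(ℝ, E) X Y x) := by
  have hx := C.mem_indexAt x
  -- With u the coordinate of s, ∇_X ∇_Y s expands to X(Yu) + i X(θY) u + iθ(Y) Xu + iθ(X) Yu -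
  -- θ(X)θ(Y) u. The last three terms together are symmetric in X and Y and drop out of the
  -- commutator; the first gives [X, Y]u, and the second combines with -iθ([X, Y]) u to i dθ(X, Y)
  -- u.
  have key : ∀ X Y : VectorFields E M, C.val x (C.connexion.along X (C.connexion.along Y s) x) =
      mvfderiv 𝓘(ℝ, E) (fun y => mvfderiv 𝓘(ℝ, E) (C.coord (C.indexAt x) s) y (Y y)) x (X x) +
      Complex.I * (mvfderiv 𝓘(ℝ, E) (fun y => C.θ (C.indexAt x) y ![Y y]) x (X x) : ℝ) *
        C.val x (s x) +
      Complex.I * (C.θ (C.indexAt x) x ![Y x] : ℝ) *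
        mvfderiv 𝓘(ℝ, E) (C.coord (C.indexAt x) s) x (X x) +
      Complex.I * (C.θ (C.indexAt x) x ![X x] : ℝ) *
        (mvfderiv 𝓘(ℝ, E) (C.coord (C.indexAt x) s) x (Y x) +
          Complex.I * (C.θ (C.indexAt x) x ![Y x] : ℝ) * C.val x (s x)) := by
    intro X Y
    have h1 : C.connexion.along X (C.connexion.along Y s) x =
      C.covariantDerivative (C.connexion.along Y s) x (X x) := rfl
    have h2 : (C.connexion.along Y s) x = C.covariantDerivative s x (Y x) := rfl
    have h3 : C.coord (C.indexAt x) (C.connexion.along Y s) =ᶠ[𝓝 x]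
        fun y => mvfderiv 𝓘(ℝ, E) (C.coord (C.indexAt x) s) y (Y y) +
          Complex.I * (C.θ (C.indexAt x) y ![Y y] : ℝ) * C.coord (C.indexAt x) s y :=
      coord_covariantDerivative s Y hx
    have hs := contMDiffAt_coord s hx
    have hY := contMDiffAt_mul_potential_apply (C := C) Y hx
    rw [h1, val_covariantDerivative, h2, val_covariantDerivative, mvfderiv_congr h3,
      mvfderiv_fun_add ((contMDiffAt_mvfderiv_vectorField hs (Y.contMDiff x)).mdifferentiableAt
          (by simp)) ((contMDiffAt_complex_mul hY hs).mdifferentiableAt (by simp)), add_apply,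
      mvfderiv_complex_mul hY hs, mvfderiv_mul_potential_apply Y hx, coord_indexAt]
    ring
  apply (C.val x).injective
  have hsub : ∀ a b c : C.core.Fiber x,
      C.val x (a - b - c) = C.val x a - C.val x b - C.val x c := fun _ _ _ => rfl
  have hc : C.connexion.toFun s x (mlieBracket 𝓘(ℝ, E) X Y x) =
    C.covariantDerivative s x (mlieBracket 𝓘(ℝ, E) X Y x) := rfl
  refine Eq.trans ?_ (hsub _ _ _).symm
  rw [key X Y, key Y X, hc, val_covariantDerivative,
    mvfderiv_mlieBracket (contMDiffAt_coord s hx) (X.contMDiff x) (Y.contMDiff x),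
    Form.d_apply_vectorField (C.θ_smooth _ x hx) (X.contMDiff x) (Y.contMDiff x)]
  change _ * C.val x (s x) = _
  push_cast
  ring

end ConnexionCocycle

/-! ### Invariance of the curvature under equivalence -/

section Transfer

variable {E : Type*} [NormedAddCommGroup E] [NormedSpace ℝ E]
  {M : Type u} [TopologicalSpace M] [ChartedSpace E M]

/-- The section `φ⁻¹ ∘ s`. -/
def HermitianIso.comapSection {L : HermitianLineBundle.{u, v} E M}
    {L' : HermitianLineBundle.{u, v'} E M} (φ : HermitianIso L L') (s : L'.Sections) :
    L.Sections :=
  ⟨fun x => (φ.toFun x).symm (s x), φ.smooth_symm.comp s.contMDiff⟩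

theorem HermitianIso.mapSection_comapSection {L : HermitianLineBundle.{u, v} E M}
    {L' : HermitianLineBundle.{u, v'} E M} (φ : HermitianIso L L') (s : L'.Sections) :
    φ.mapSection (φ.comapSection s) = s :=
  ContMDiffSection.ext fun x => (φ.toFun x).apply_symm_apply (s x)

variable [CompleteSpace E] [IsManifold 𝓘(ℝ, E) ∞ M]

/-- The smooth vector field `[X, Y]`. -/
def VectorFields.bracket (X Y : VectorFields E M) : VectorFields E M :=
  ⟨mlieBracket 𝓘(ℝ, E) X Y, fun x => by
    have : IsManifold 𝓘(ℝ, E) (minSmoothness ℝ 2) M := by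
      rw [minSmoothness_of_isRCLikeNormedField]
      exact IsManifold.of_le (n := ∞) ENat.LEInfty.out
    -- Since ∞ + 1 is ∞, the derivative lost in forming a bracket costs no smoothness.
    have : IsManifold 𝓘(ℝ, E) (((⊤ : ℕ∞) : ℕ∞ω) + 1) M := inferInstanceAs (IsManifold _ ∞ M)
    refine ContMDiffAt.mlieBracket_vectorField (m := ⊤) (n := ⊤) (X.contMDiff x) (Y.contMDiff x) ?_
    rw [minSmoothness_of_isRCLikeNormedField]
    rfl⟩

/-- Equivalent connexions have the same curvature. -/
theorem HermitianConnexion.HasCurvature.of_equivalent {L : HermitianLineBundle.{u, v} E M}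
    {L' : HermitianLineBundle.{u, v'} E M} {D : HermitianConnexion L} {D' : HermitianConnexion L'}
    {K : Form E M ℂ 2} (hK : D.HasCurvature K) (h : D.Equivalent D') : D'.HasCurvature K := by
  obtain ⟨φ, hφ⟩ := h
  refine ⟨hK.smooth, hK.imaginary, fun X Y s x => ?_⟩
  obtain ⟨t, rfl⟩ : ∃ t, φ.mapSection t = s := ⟨_, φ.mapSection_comapSection s⟩
  have hφ' : ∀ (s : L.Sections) (X : VectorFields E M),
      D'.along X (φ.mapSection s) = φ.mapSection (D.along X s) :=
    fun s X => ContMDiffSection.ext fun x => (hφ s X x).symm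
  -- Equivalence is a condition on smooth vector fields only, so the bracket term requires [X, Y] as
  -- such a field.
  have hb : D'.toFun (φ.mapSection t) x (mlieBracket 𝓘(ℝ, E) X Y x) =
      φ.toFun x (D.toFun t x (mlieBracket 𝓘(ℝ, E) X Y x)) :=
    (hφ t (VectorFields.bracket X Y) x).symm
  rw [hb, hφ', hφ', hφ', hφ']
  have h := congrArg (φ.toFun x) (hK.curvature X Y t x)
  rw [map_smul, map_sub, map_sub] at h
  exact h

end Transfer

/-! ### Phases of real functions -/

section Exponential

variable {E : Type*} [NormedAddCommGroup E] [NormedSpace ℝ E]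
  {M : Type*} [TopologicalSpace M] [ChartedSpace E M]

theorem contMDiffAt_exp_mul_I {r : M → ℝ} {x : M} (hr : ContMDiffAt 𝓘(ℝ, E) 𝓘(ℝ, ℝ) ∞ r x) :
    ContMDiffAt 𝓘(ℝ, E) 𝓘(ℝ, ℂ) ∞ (fun y => Complex.exp (-(Complex.I * r y))) x := by
  have h : ContDiff ℝ ∞ fun t : ℝ => Complex.exp (-(Complex.I * t)) :=
    (contDiff_const.mul Complex.ofRealCLM.contDiff).neg.cexp
  exact h.contMDiff.contMDiffAt.comp x hr

theorem mvfderiv_exp_mul_I {r : M → ℝ} {x : M} (hr : ContMDiffAt 𝓘(ℝ, E) 𝓘(ℝ, ℝ) ∞ r x)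
    (v : TangentSpace 𝓘(ℝ, E) x) :
    mvfderiv 𝓘(ℝ, E) (fun y => Complex.exp (-(Complex.I * r y))) x v =
      -(Complex.I * (mvfderiv 𝓘(ℝ, E) r x v : ℝ)) * Complex.exp (-(Complex.I * r x)) := by
  have hd : HasDerivAt (fun t : ℝ => Complex.exp (-(Complex.I * t)))
      (Complex.exp (-(Complex.I * r x)) * -(Complex.I * 1)) (r x) :=
    (((Complex.ofRealCLM.hasDerivAt (x := r x)).const_mul Complex.I).neg).cexp
  have h := mfderiv_comp_apply x (I := 𝓘(ℝ, E)) (I' := 𝓘(ℝ, ℝ)) (I'' := 𝓘(ℝ, ℂ))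
    (g := fun t : ℝ => Complex.exp (-(Complex.I * t)))
    hd.differentiableAt.mdifferentiableAt (hr.mdifferentiableAt (by simp)) v
  rw [mfderiv_eq_fderiv, hd.hasFDerivAt.fderiv] at h
  refine h.trans ?_
  change (mvfderiv 𝓘(ℝ, E) r x v : ℝ) • (Complex.exp (-(Complex.I * r x)) * -(Complex.I * 1)) = _
  rw [Complex.real_smul]
  ring

end Exponential

/-! ### From Čech–de Rham data to a unitary cocycle -/

section Gluing

variable {E : Type*} [NormedAddCommGroup E] [NormedSpace ℝ E]
  {M : Type u} [TopologicalSpace M] [ChartedSpace E M] {ι : Type v}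
  {U : ι → TopologicalSpace.Opens M}

theorem mem_inter_one {i : ι} {x : M} (hi : x ∈ U i) : x ∈ inter U ![i] := by
  simpa [inter] using hi

theorem mem_inter_two {i j : ι} {x : M} (hi : x ∈ U i) (hj : x ∈ U j) : x ∈ inter U ![i, j] := by
  simpa [inter, Fin.forall_fin_succ] using ⟨hi, hj⟩

theorem mem_inter_three {i j k : ι} {x : M} (hi : x ∈ U i) (hj : x ∈ U j) (hk : x ∈ U k) :
    x ∈ inter U ![i, j, k] := by
  simpa [inter, Fin.forall_fin_succ] using ⟨hi, hj, hk⟩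

theorem cechδ_zero {A : Type*} [AddCommGroup A] (c : (Fin 1 → ι) → A) (i j : ι) :
    cechδ c ![i, j] = c ![j] - c ![i] := by
  have h0 : ![i, j] ∘ Fin.succAbove 0 = ![j] := by ext m; fin_cases m; rfl
  have h1 : ![i, j] ∘ Fin.succAbove 1 = ![i] := by ext m; fin_cases m; rfl
  change ∑ m : Fin 2, (-1 : ℤ) ^ (m : ℕ) • c (![i, j] ∘ m.succAbove) = _
  rw [Fin.sum_univ_two, h0, h1]
  simp [sub_eq_add_neg]

theorem cechδ_one {A : Type*} [AddCommGroup A] (c : (Fin 2 → ι) → A) (i j k : ι) :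
    cechδ c ![i, j, k] = c ![j, k] - c ![i, k] + c ![i, j] := by
  have h0 : ![i, j, k] ∘ Fin.succAbove 0 = ![j, k] := by ext m; fin_cases m <;> rfl
  have h1 : ![i, j, k] ∘ Fin.succAbove 1 = ![i, k] := by ext m; fin_cases m <;> rfl
  have h2 : ![i, j, k] ∘ Fin.succAbove 2 = ![i, j] := by ext m; fin_cases m <;> rfl
  change ∑ m : Fin 3, (-1 : ℤ) ^ (m : ℕ) • c (![i, j, k] ∘ m.succAbove) = _
  rw [Fin.sum_univ_three, h0, h1, h2]
  simp [sub_eq_add_neg]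

variable [IsManifold 𝓘(ℝ, E) ∞ M]

/-- An integral class has a `U(1)`-cocycle with local potentials. -/
theorem exists_connexionCocycle (hU : ⨆ i, U i = ⊤) {n : (Fin 3 → ι) → M → ℤ} {Ω : Form E M ℝ 2}
    (h : CechDeRhamCohomologous U (fun a x => 2 * Real.pi * n a x) Ω) :
    ∃ C : ConnexionCocycle E U, ∀ i, ∀ x ∈ U i, (C.θ i).d x = Ω x := by
  obtain ⟨θ, f, hθ, hf, hdθ, hδθ, hδf⟩ := h
  have hcover : ∀ x, ∃ i, x ∈ U i := fun x => by
    have hx : x ∈ ⨆ i, U i := hU ▸ TopologicalSpace.Opens.mem_top x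
    simpa using hx
  choose idx hidx using hcover
  have hsum : ∀ i j k x, x ∈ U i → x ∈ U j → x ∈ U k →
      f ![j, k] x ![] - f ![i, k] x ![] + f ![i, j] x ![] = -(2 * Real.pi * n ![i, j, k] x) := by
    intro i j k x hi hj hk
    have h := hδf ![i, j, k] x (mem_inter_three hi hj hk)
    rw [cechδ_one] at h
    exact congrArg (fun η : E [⋀^Fin 0]→L[ℝ] ℝ => η ![]) h
  -- Cochains are not assumed alternating, so f_ii need not vanish; the relation at (i, i, i) puts
  -- it in 2πℤ, which is enough for g_ii = 1.
  have hself : ∀ i x, x ∈ U i → f ![i, i] x ![] = -(2 * Real.pi * n ![i, i, i] x) := by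
    intro i x hi
    rw [← hsum i i i x hi hi hi]
    ring
  have hexp : ∀ k : ℤ, Complex.exp (Complex.I * (2 * Real.pi * k)) = 1 := by
    intro k
    rw [← Complex.exp_int_mul_two_pi_mul_I k]
    congr 1
    ring
  have hfs : ∀ i j x, x ∈ U i → x ∈ U j →
      ContMDiffAt 𝓘(ℝ, E) 𝓘(ℝ, ℝ) ∞ (fun y => f ![i, j] y ![]) x :=
    fun i j x hi hj => contMDiffAt_zeroForm (hf _ x (mem_inter_two hi hj))
  refine ⟨{
    -- The sign is forced by df_ij = θ_j - θ_i together with the required dg_ij = i(θ_i - θ_j) g_ij.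
    g := fun i j x => Complex.exp (-(Complex.I * (f ![i, j] x ![] : ℝ)))
    θ := fun i => θ ![i]
    indexAt := idx
    mem_indexAt := hidx
    g_smooth := fun i j x hi hj => contMDiffAt_exp_mul_I (hfs i j x hi hj)
    θ_smooth := fun i x hi => hθ _ x (mem_inter_one hi)
    g_star := ?_
    g_self := ?_
    g_comp := ?_
    mvfderiv_g := ?_ }, fun i x hi => hdθ _ x (mem_inter_one hi)⟩
  · intro i j x _ _
    have h : star (Complex.exp (-(Complex.I * (f ![i, j] x ![] : ℝ)))) =
        Complex.exp (Complex.I * (f ![i, j] x ![] : ℝ)) := by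
      refine (Complex.exp_conj _).symm.trans ?_
      rw [map_neg, map_mul, Complex.conj_I, Complex.conj_ofReal, neg_mul, neg_neg]
    rw [h, ← Complex.exp_add, add_neg_cancel, Complex.exp_zero]
  · intro i x hi
    rw [hself i x hi, ← hexp (n ![i, i, i] x)]
    congr 1
    push_cast
    ring
  · intro i j k x hi hj hk
    have h := hsum i j k x hi hj hk
    -- The factor 1 is written as exp(2πi n_ijk) to absorb the defect of additivity of f.
    rw [← Complex.exp_add, ← mul_one (Complex.exp (-(Complex.I * (f ![i, k] x ![] : ℝ)))),
      ← hexp (n ![i, j, k] x), ← Complex.exp_add]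
    congr 1
    have h' : (f ![j, k] x ![] : ℂ) - (f ![i, k] x ![] : ℝ) + (f ![i, j] x ![] : ℝ) =
      -(2 * Real.pi * n ![i, j, k] x) := by exact_mod_cast congrArg (fun t : ℝ => (t : ℂ)) h
    linear_combination -Complex.I * h'
  · intro i j x hi hj v
    have h := hδθ ![i, j] x (mem_inter_two hi hj)
    rw [cechδ_zero, sub_eq_zero] at h
    have h' : θ ![j] x ![v] - θ ![i] x ![v] = (f ![i, j]).d x ![v] :=
      congrArg (fun η : E [⋀^Fin 1]→L[ℝ] ℝ => η ![v]) h
    rw [mvfderiv_exp_mul_I (hfs i j x hi hj),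
      ← Form.d_zeroForm_apply (hf _ x (mem_inter_two hi hj)), ← h']
    push_cast
    ring

end Gluing

end LineBundle

end

/-! ### The main theorem -/

open LineBundle in
theorem mainTheorem5 {E : Type*} [NormedAddCommGroup E] [NormedSpace ℝ E] [FiniteDimensional ℝ E]
    {M : Type u} [TopologicalSpace M] [ChartedSpace E M] [IsManifold 𝓘(ℝ, E) ∞ M]
    [T2Space M] [SecondCountableTopology M]
    (e : ℝ) (he : e ≠ 0) (Ω : Form E M ℝ 2) (hsmooth : Ω.SmoothOn Set.univ)
    (hclosed : ∀ x, Ω.d x = 0) (hint : HasIntegralClass (fun x => e⁻¹ • Ω x)) :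
    ∃ (L : HermitianLineBundle.{u, 0} E M) (D : HermitianConnexion L),
      D.HasCurvature (Ω.complexMul (Complex.I / e)) ∧
      ∀ (L' : HermitianLineBundle.{u, v} E M) (D' : HermitianConnexion L'),
        D.Equivalent D' → D'.HasCurvature (Ω.complexMul (Complex.I / e)) := by
  have : CompleteSpace E := FiniteDimensional.complete ℝ E
  obtain ⟨ι, U, hU, n, -, h⟩ := hint
  -- The integral form is Ω/e, so the potentials satisfy dθ = Ω/e and the curvature i dθ becomes
  -- (i/e) Ω.
  obtain ⟨C, hC⟩ := exists_connexionCocycle hU h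
  have hcurv : C.connexion.HasCurvature (Ω.complexMul (Complex.I / e)) := by
    refine ⟨Form.smoothOn_complexMul hsmooth _, fun x v => ?_, fun X Y s x => ?_⟩
    · change (Complex.I / e * (Ω x v : ℝ)).re = 0
      rw [Complex.re_mul_ofReal, Complex.div_ofReal_re, Complex.I_re, zero_div, zero_mul]
    · rw [← ConnexionCocycle.curvature_connexion, hC _ x (C.mem_indexAt x)]
      congr 1
      change Complex.I / e * (Ω x ![X x, Y x] : ℝ) = Complex.I * ((e⁻¹ * Ω x ![X x, Y x] : ℝ) : ℂ)
      push_cast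
      ring
  exact ⟨C.lineBundle, C.connexion, hcurv, fun L' D' hD => hcurv.of_equivalent hD⟩
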